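/- Let $\lambda>0$ and let $\{\tau_i\}$ be the points of a homogeneous Poisson point process on $\mathbb{R}$ with intensity $\lambda\,ds$. Let $g:\mathbb{R}\to\mathbb{R}$ be a measurable function in $L^1(\mathbb{R})$. For $t\in\mathbb{R}$ and $M>0$ put $$X(t)=\sum_i \beta_i\, g(t-\tau_i),\qquad X_M(t)=\sum_{i:\,|\tau_i|\le M}\beta_i\, g(t-\tau_i),\qquad \gamma_M=\#\{i:\ \tau_i\in[-M,M]\},$$ where $\beta_i=1$ almost surely for all $i$. Let $T>0$ and $a<b$, and assume that $g$ is of class $C^2$ on $[-T+a,T+b]$ (with one-sided derivatives at the endpoints) and that $$m=\min_{s\in[-T+a,T+b]}\sqrt{g'(s)^2+g''(s)^2}>0,\qquad n_0=\#\{s\in[-T+a,T+b]:\ g''(s)=0\}<\infty .$$ Let $k_0\ge 3$ be an integer. Then, for every $t\in\mathbb{R}$, the series $X(t)$ converges absolutely almost surely, and: 1. for all $t\in[a,b]$ and all $M\ge T$, the law of $X_M(t)$ conditionally on $\{\gamma_T\ge k_0\}$ has a continuous bounded density with respect to Lebesgue measure; 2. for all $t\in[a,b]$, the law of $X(t)$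 conditionally on $\{\gamma_T\ge k_0\}$ has a continuous bounded density; 3. more generally, for all $t\in\mathbb{R}$ and all $s\in[a,b]$, the law of $X(t)$ conditionally on $\{\#\{i:\ \tau_i\in[t-s-T,\,t-s+T]\}\ge k_0\}$ has a continuous bounded density. -/

import Mathlib

open MeasureTheory ProbabilityTheory Set
open scoped ENNReal NNReal

namespace ShotNoise

noncomputable section

/-- The number (possibly infinite) of indices `i` whose point `τ i ω` lies in `B`. -/
def count {ι Ω : Type*} (τ : ι → Ω → ℝ) (B : Set ℝ) (ω : Ω) : ℕ∞ :=
  {i | τ i ω ∈ B}.encard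

/-- The random points `τ i` form a Poisson point process on the line with intensity measure `ν`:
the number of points in a Borel set `B` is Poisson distributed with parameter `ν B` (and is a.s.
infinite if `ν B = ∞`), and the numbers of points in disjoint Borel sets are independent. -/
structure IsPoissonPointProcess {ι Ω : Type*} [MeasurableSpace Ω] (τ : ι → Ω → ℝ)
    (ν : Measure ℝ) (P : Measure Ω) : Prop where
  measurable : ∀ i, Measurable (τ i)
  count_law : ∀ B : Set ℝ, MeasurableSet B → ν B ≠ ∞ →
    HasLaw (count τ B) ((poissonMeasure (ν B).toNNReal).map (fun k : ℕ => (k : ℕ∞))) P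
  count_top : ∀ B : Set ℝ, MeasurableSet B → ν B = ∞ → ∀ᵐ ω ∂P, count τ B ω = ⊤
  indep : ∀ (n : ℕ) (B : Fin n → Set ℝ), (∀ j, MeasurableSet (B j)) →
    Pairwise (fun j k => Disjoint (B j) (B k)) → iIndepFun (fun j => count τ (B j)) P

/-- The shot noise process `X(t) = ∑ i, β i * g (t - τ i)`. -/
def shotNoise {ι Ω : Type*} (β : ι → Ω → ℝ) (g : ℝ → ℝ) (τ : ι → Ω → ℝ) (t : ℝ) (ω : Ω) : ℝ :=
  ∑' i, β i ω * g (t - τ i ω)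

/-- The truncated shot noise process `X_M(t)`: the sum is over the indices with `|τ i| ≤ M`. -/
def truncShotNoise {ι Ω : Type*} (β : ι → Ω → ℝ) (g : ℝ → ℝ) (τ : ι → Ω → ℝ) (M t : ℝ)
    (ω : Ω) : ℝ :=
  ∑' i : {i // |τ i ω| ≤ M}, β i ω * g (t - τ i ω)

/-- The law of the real random variable `Y` under `Q` has a continuous bounded density with
respect to Lebesgue measure. -/
def HasContinuousBoundedDensity {Ω : Type*} [MeasurableSpace Ω] (Y : Ω → ℝ) (Q : Measure Ω) :
    Prop :=
  ∃ f : ℝ → ℝ, Continuous f ∧ (∀ x, 0 ≤ f x) ∧ (∃ C, ∀ x, f x ≤ C) ∧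
    HasLaw Y (volume.withDensity (fun x => ENNReal.ofReal (f x))) Q

end

end ShotNoise

/-! A finite measure whose characteristic function is integrable has a continuous bounded density,
so it suffices to bound the conditional characteristic function by a multiple of `(1 + |u|) ^
(-3/2)`.

Let `W` be the window, `ν` the intensity measure, `f` the kernel `x ↦ g (t - x)`, and `J = |∫_W exp
(i u f) dν|`. Given that `W` contains exactly `k` points, these are distributed like `k` independent
points with law `ν` normalised on `W`, and they are independent of the points outside `W`, which
contribute a factor of modulus at most 1. Hence the characteristic function restricted to that event
is at most `exp (-ν W) * J ^ k / k!`. Summing over `k ≥ k₀ ≥ 3` and using `J ≤ ν W` leaves at most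
`J ^ 3` (`norm_setIntegral_cexp_le_count_le`).

Since `m > 0`, `g'` and `g''` have no common zero, so every stationary point of the phase is
nondegenerate and van der Corput's estimate gives `J = O((1 + |u|) ^ (-1/2))`
(`exists_norm_integral_cexp_le`). Three points in the window thus yield the exponent `-3/2`, whereas
two would yield only the non-integrable `-1`. -/

namespace ShotNoise

/-! ### Fourier inversion: an integrable characteristic function gives a continuous bounded density.
-/

section FourierInversion

open Filter Topology Real FourierTransform

/-- The inverse Fourier transform of the characteristic function of a centred Gaussian law. -/
lemma integral_cexp_mul_gaussian {v : ℝ≥0} (hv : v ≠ 0) (s : ℝ) :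
    ∫ ξ : ℝ, Complex.exp (((-2 * π * (ξ * s) : ℝ) : ℂ) * Complex.I) *
      ((rexp (-(2 * π ^ 2 * v) * ξ ^ 2) : ℝ) : ℂ) = ((gaussianPDFReal 0 v s : ℝ) : ℂ) := by
  have hv' : (0 : ℝ) < v := by positivity
  have hb : 0 < (((2 * π * v : ℝ)) : ℂ).re := by
    rw [Complex.ofReal_re]; positivity
  have h := congrFun (fourier_gaussian_pi hb) s
  rw [Real.fourier_eq'] at h
  convert h using 1
  · refine integral_congr_ae (Eventually.of_forall fun ξ => ?_)
    simp only [smul_eq_mul]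
    congr 2
    · simp [mul_comm]
    · push_cast
      congr 1
      ring
  · rw [gaussianPDFReal]
    have h2 : (((2 * π * v : ℝ)) : ℂ) ^ (1 / 2 : ℂ) = ((√(2 * π * v) : ℝ) : ℂ) := by
      rw [Real.sqrt_eq_rpow, Complex.ofReal_cpow (by positivity)]
      norm_num
    rw [h2]
    push_cast
    have hp : (π : ℂ) ≠ 0 := by exact_mod_cast Real.pi_ne_zero
    have hvc : ((v : ℝ) : ℂ) ≠ 0 := by exact_mod_cast hv'.ne'
    rw [one_div]
    congr 2
    field_simp
    ring

/-- Fubini, with the Gaussian factor providing integrability. The right side is the density at `x`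
of `μ` convolved with a centred Gaussian of variance `v`. -/
lemma integral_cexp_mul_gaussian_mul_charFun (μ : Measure ℝ) [IsFiniteMeasure μ] {v : ℝ≥0}
    (hv : v ≠ 0) (x : ℝ) :
    ∫ ξ : ℝ, Complex.exp (((-2 * π * (ξ * x) : ℝ) : ℂ) * Complex.I) *
      (((rexp (-(2 * π ^ 2 * v) * ξ ^ 2) : ℝ) : ℂ) * charFun μ (2 * π * ξ)) =
      ((∫ y, gaussianPDFReal y v x ∂μ : ℝ) : ℂ) := by
  have hv' : (0 : ℝ) < v := by positivity
  have e1 : ∀ ξ : ℝ, Complex.exp (((-2 * π * (ξ * x) : ℝ) : ℂ) * Complex.I) *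
      (((rexp (-(2 * π ^ 2 * v) * ξ ^ 2) : ℝ) : ℂ) * charFun μ (2 * π * ξ)) =
      ∫ y, Complex.exp (((-2 * π * (ξ * (x - y)) : ℝ) : ℂ) * Complex.I) *
      ((rexp (-(2 * π ^ 2 * v) * ξ ^ 2) : ℝ) : ℂ) ∂μ := by
    intro ξ
    rw [charFun_apply_real, ← integral_const_mul, ← integral_const_mul]
    refine integral_congr_ae (Eventually.of_forall fun y => ?_)
    simp only
    rw [mul_left_comm, ← Complex.exp_add, mul_comm]
    congr 2
    push_cast
    ring
  simp_rw [e1]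
  rw [integral_integral_swap]
  · rw [← integral_complex_ofReal]
    refine integral_congr_ae (Eventually.of_forall fun y => ?_)
    simp only
    rw [integral_cexp_mul_gaussian hv, gaussianPDFReal, gaussianPDFReal]
    simp
  · have hi : Integrable (fun p : ℝ × ℝ => rexp (-(2 * π ^ 2 * v) * p.1 ^ 2))
        ((volume : Measure ℝ).prod μ) :=
      (integrable_exp_neg_mul_sq (b := 2 * π ^ 2 * v) (by positivity)).comp_fst μ
    refine hi.mono' (by fun_prop) (Eventually.of_forall fun p => ?_)
    simp only [Function.uncurry]
    rw [norm_mul, Complex.norm_exp_ofReal_mul_I, one_mul, Complex.norm_real, Real.norm_eq_abs,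
      abs_of_pos (Real.exp_pos _)]

/-- A finite measure on the line with integrable characteristic function has a continuous bounded
density. -/
theorem exists_continuous_density_of_integrable_charFun (μ : Measure ℝ) [IsFiniteMeasure μ]
    (hμ : Integrable (charFun μ)) :
    ∃ f : ℝ → ℝ, Continuous f ∧ (∀ x, 0 ≤ f x) ∧ (∃ C, ∀ x, f x ≤ C) ∧
      μ = volume.withDensity (fun x => ENNReal.ofReal (f x)) := by
  set φ : ℝ → ℂ := fun ξ => charFun μ (2 * π * ξ) with hφ
  have hφc : Continuous φ := continuous_charFun.comp (by fun_prop)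
  have hφi : Integrable φ := hμ.comp_mul_left' (by positivity)
  have hFeq : ∀ x, 𝓕 φ x =
      ∫ ξ : ℝ, Complex.exp (((-2 * π * (ξ * x) : ℝ) : ℂ) * Complex.I) * φ ξ := by
    intro x
    rw [Real.fourier_eq']
    simp only [smul_eq_mul, RCLike.inner_apply, conj_trivial, mul_comm x]
  have hFc : Continuous (𝓕 φ) :=
    VectorFourier.fourierIntegral_continuous Real.continuous_fourierChar
      (by exact continuous_inner) hφi
  have hFb : ∀ x, ‖𝓕 φ x‖ ≤ ∫ ξ, ‖φ ξ‖ := fun x =>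
    VectorFourier.norm_fourierIntegral_le_integral_norm _ _ _ _ _
  -- Gaussian smoothing with variance tending to 0: the smoothed densities `G n` are nonnegative and
  -- converge pointwise to `𝓕 φ`, which is therefore real and nonnegative.
  set v : ℕ → ℝ≥0 := fun n => 1 / ((n : ℝ≥0) + 1) with hvdef
  have hv0 : ∀ n, v n ≠ 0 := fun n => by simp only [hvdef]; positivity
  have hvlim : Tendsto (fun n => (v n : ℝ)) atTop (𝓝 0) := by
    simpa [hvdef] using tendsto_one_div_add_atTop_nhds_zero_nat (𝕜 := ℝ)
  set G : ℕ → ℝ → ℝ := fun n x => ∫ y, gaussianPDFReal y (v n) x ∂μ with hG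
  have hG0 : ∀ n x, 0 ≤ G n x := fun n x =>
    integral_nonneg fun y => gaussianPDFReal_nonneg _ _ _
  have hlim : ∀ x, Tendsto (fun n => ((G n x : ℝ) : ℂ)) atTop (𝓝 (𝓕 φ x)) := by
    intro x
    rw [hFeq]
    simp_rw [hG, ← integral_cexp_mul_gaussian_mul_charFun μ (hv0 _)]
    refine tendsto_integral_of_dominated_convergence (fun ξ => ‖φ ξ‖) ?_ hφi.norm ?_ ?_
    · intro n
      refine Continuous.aestronglyMeasurable ?_
      have : Continuous fun ξ : ℝ => charFun μ (2 * π * ξ) := hφc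
      fun_prop
    · intro n
      refine Eventually.of_forall fun ξ => ?_
      rw [norm_mul, Complex.norm_exp_ofReal_mul_I, one_mul, norm_mul, Complex.norm_real,
        Real.norm_eq_abs, abs_of_pos (Real.exp_pos _)]
      refine mul_le_of_le_one_left (norm_nonneg _) (Real.exp_le_one_iff.2 ?_)
      have : 0 ≤ 2 * π ^ 2 * (v n : ℝ) * ξ ^ 2 := by positivity
      linarith
    · refine Eventually.of_forall fun ξ => ?_
      have h1 : Tendsto (fun n => ((rexp (-(2 * π ^ 2 * v n) * ξ ^ 2) : ℝ) : ℂ)) atTop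
          (𝓝 ((rexp (-(2 * π ^ 2 * 0) * ξ ^ 2) : ℝ) : ℂ)) :=
        (Complex.continuous_ofReal.tendsto _).comp ((Real.continuous_exp.tendsto _).comp
          (((hvlim.const_mul _).neg).mul_const _))
      have h2 := (h1.mul_const (φ ξ)).const_mul
        (Complex.exp (((-2 * π * (ξ * x) : ℝ) : ℂ) * Complex.I))
      simpa using h2
  set f : ℝ → ℝ := fun x => (𝓕 φ x).re with hf
  have hlimre : ∀ x, Tendsto (fun n => G n x) atTop (𝓝 (f x)) := fun x => by
    exact (Complex.continuous_re.tendsto _).comp (hlim x)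
  have hf0 : ∀ x, 0 ≤ f x := fun x => ge_of_tendsto' (hlimre x) fun n => hG0 n x
  have hFf : ∀ x, 𝓕 φ x = (f x : ℂ) := fun x =>
    tendsto_nhds_unique (hlim x) ((Complex.continuous_ofReal.tendsto _).comp (hlimre x))
  have hfc : Continuous f := Complex.continuous_re.comp hFc
  have hmeas : ∀ n, Measurable (fun p : ℝ × ℝ => ENNReal.ofReal (gaussianPDFReal p.2 (v n) p.1)) :=
    fun n => by
      unfold gaussianPDFReal
      fun_prop
  -- Fatou: each smoothed density has total mass `μ univ`. The resulting integrability of `f` is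
  -- what allows Fourier inversion below.
  have hfin : ∫⁻ x, ENNReal.ofReal (f x) ≤ μ univ := by
    have h1 : ∀ x, ENNReal.ofReal (f x) ≤
        liminf (fun n => ∫⁻ y, ENNReal.ofReal (gaussianPDFReal y (v n) x) ∂μ) atTop := by
      intro x
      have h2 : Tendsto (fun n => ENNReal.ofReal (G n x)) atTop (𝓝 (ENNReal.ofReal (f x))) :=
        (ENNReal.continuous_ofReal.tendsto _).comp (hlimre x)
      rw [← h2.liminf_eq]
      refine liminf_le_liminf (Eventually.of_forall fun n => ?_)
      simp only [hG]
      rw [integral_eq_lintegral_of_nonneg_ae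
        (Eventually.of_forall fun y => gaussianPDFReal_nonneg _ _ _)
        (by unfold gaussianPDFReal; fun_prop)]
      exact ENNReal.ofReal_toReal_le
    calc ∫⁻ x, ENNReal.ofReal (f x)
        ≤ ∫⁻ x, liminf (fun n => ∫⁻ y, ENNReal.ofReal (gaussianPDFReal y (v n) x) ∂μ) atTop :=
          lintegral_mono h1
      _ ≤ liminf (fun n => ∫⁻ x, ∫⁻ y, ENNReal.ofReal (gaussianPDFReal y (v n) x) ∂μ) atTop :=
          lintegral_liminf_le fun n => (hmeas n).lintegral_prod_right'
      _ = liminf (fun _ : ℕ => μ univ) atTop := by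
          congr 1
          funext n
          rw [lintegral_lintegral_swap (hmeas n).aemeasurable]
          simp [lintegral_gaussianPDFReal_eq_one _ (hv0 n)]
      _ = μ univ := by simp
  have hfi : Integrable f := by
    refine ⟨hfc.aestronglyMeasurable, ?_⟩
    rw [hasFiniteIntegral_iff_ofReal (Eventually.of_forall hf0)]
    exact hfin.trans_lt (measure_lt_top μ _)
  have hFi : Integrable (𝓕 φ) := by
    rw [funext hFf]
    exact hfi.ofReal
  refine ⟨f, hfc, hf0, ⟨∫ ξ, ‖φ ξ‖, fun x => (Complex.re_le_norm _).trans (hFb x)⟩, ?_⟩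
  have : IsFiniteMeasure (volume.withDensity (fun x => ENNReal.ofReal (f x))) :=
    isFiniteMeasure_withDensity_ofReal hfi.2
  refine Measure.ext_of_charFun (funext fun t => ?_)
  -- The division by `2 * π` undoes the rescaling in `φ`, so inversion returns `charFun μ t` itself.
  have hinv := congrFun (hφc.fourierInv_fourier_eq hφi hFi) (t / (2 * π))
  have ht : 2 * π * (t / (2 * π)) = t := by field_simp
  simp only [hφ, ht] at hinv
  rw [← hinv, charFun_apply_real, Real.fourierInv_eq',
    integral_withDensity_eq_integral_toReal_smul (by fun_prop) (by simp)]
  refine integral_congr_ae (Eventually.of_forall fun y => ?_)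
  simp only
  have := hFf y
  simp only [hφ] at this
  rw [this, ENNReal.toReal_ofReal (hf0 y), smul_eq_mul, Complex.real_smul, mul_comm]
  congr 3
  simp only [RCLike.inner_apply, conj_trivial]
  push_cast
  have hp : (π : ℂ) ≠ 0 := by exact_mod_cast Real.pi_ne_zero
  field_simp

end FourierInversion

/-! ### Van der Corput's estimate by a regularised integration by parts. -/

section OscillatoryIntegral

open Filter Topology Real

variable {p q : ℝ} {g h h₂ : ℝ → ℝ}

/-- `arctan (h / ε) / ε` is a primitive of `h₂ / (h ^ 2 + ε ^ 2)` with total variation at most `π /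
ε`; inserting `h₂ / δ ≥ 1` costs the factor `1 / δ`. -/
lemma lintegral_inv_sq_add_sq_le_of_le_deriv (hpq : p ≤ q) (hh : ContinuousOn h (Icc p q))
    (hd : ∀ x ∈ Ioo p q, HasDerivAt h (h₂ x) x) (hh₂ : ContinuousOn h₂ (Icc p q))
    {δ ε : ℝ} (hδ : 0 < δ) (hε : 0 < ε) (hle : ∀ x ∈ Icc p q, δ ≤ h₂ x) :
    ∫⁻ x in Icc p q, ENNReal.ofReal (1 / (h x ^ 2 + ε ^ 2)) ≤ ENNReal.ofReal (π / δ / ε) := by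
  have hpos : ∀ x, 0 < h x ^ 2 + ε ^ 2 := fun x => by positivity
  have hc : ContinuousOn (fun x => 1 / (h x ^ 2 + ε ^ 2)) (Icc p q) :=
    continuousOn_const.div (by fun_prop) fun x _ => (hpos x).ne'
  have hc' : ContinuousOn (fun x => h₂ x / (h x ^ 2 + ε ^ 2)) (Icc p q) :=
    hh₂.div (by fun_prop) fun x _ => (hpos x).ne'
  have hftc : ∫ x in p..q, h₂ x / (h x ^ 2 + ε ^ 2) =
      arctan (h q / ε) / ε - arctan (h p / ε) / ε := by
    refine intervalIntegral.integral_eq_sub_of_hasDerivAt_of_le hpq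
      (f := fun x => arctan (h x / ε) / ε) ?_ (fun x hx => ?_)
      (hc'.intervalIntegrable_of_Icc hpq)
    · exact ((Real.continuous_arctan.comp_continuousOn (hh.div_const ε))).div_const ε
    · have := (((hd x hx).div_const ε).arctan).div_const ε
      refine this.congr_deriv ?_
      have := (hpos x).ne'
      field_simp
      ring
  rw [← ofReal_integral_eq_lintegral_ofReal (hc.integrableOn_compact isCompact_Icc)
    (Eventually.of_forall fun x => by have := hpos x; positivity)]
  refine ENNReal.ofReal_le_ofReal ?_
  rw [integral_Icc_eq_integral_Ioc, ← intervalIntegral.integral_of_le hpq]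
  calc ∫ x in p..q, 1 / (h x ^ 2 + ε ^ 2)
      ≤ ∫ x in p..q, 1 / δ * (h₂ x / (h x ^ 2 + ε ^ 2)) := by
        refine intervalIntegral.integral_mono_on hpq (hc.intervalIntegrable_of_Icc hpq)
          ((hc'.intervalIntegrable_of_Icc hpq).const_mul _) fun x hx => ?_
        rw [div_mul_div_comm, one_mul, div_le_div_iff₀ (hpos x) (mul_pos hδ (hpos x))]
        nlinarith [hle x hx, hpos x]
    _ = 1 / δ * (arctan (h q / ε) / ε - arctan (h p / ε) / ε) := by
        rw [intervalIntegral.integral_const_mul, hftc]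
    _ ≤ 1 / δ * (π / ε) := by
        refine mul_le_mul_of_nonneg_left ?_ (by positivity)
        rw [← sub_div]
        refine div_le_div_of_nonneg_right ?_ hε.le
        linarith [Real.arctan_lt_pi_div_two (h q / ε), Real.neg_pi_div_two_lt_arctan (h p / ε)]
    _ = π / δ / ε := by field_simp

lemma lintegral_inv_sq_add_sq_le_of_deriv_pos {x : ℝ} (hx : x ∈ Icc p q)
    (hh : ContinuousOn h (Icc p q)) (hd : ∀ x ∈ Ioo p q, HasDerivAt h (h₂ x) x)
    (hh₂ : ContinuousOn h₂ (Icc p q)) (hpos : 0 < h₂ x) :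
    ∃ t ∈ 𝓝[Icc p q] x, ∃ C : ℝ, ∀ ε : ℝ, 0 < ε → ε ≤ 1 →
      ∫⁻ x in t, ENNReal.ofReal (1 / (h x ^ 2 + ε ^ 2)) ≤ ENNReal.ofReal (C / ε) := by
  have hev : ∀ᶠ y in 𝓝[Icc p q] x, h₂ x / 2 < h₂ y :=
    (hh₂ x hx).eventually (lt_mem_nhds (by linarith))
  obtain ⟨r, hr, hball⟩ := (nhdsWithin_hasBasis Metric.nhds_basis_closedBall (Icc p q)).mem_iff.1 hev
  rw [Real.closedBall_eq_Icc] at hball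
  have hsub : Icc (max (x - r) p) (min (x + r) q) ⊆ Icc p q :=
    Icc_subset_Icc (le_max_right _ _) (min_le_right _ _)
  refine ⟨Icc (x - r) (x + r) ∩ Icc p q, ?_, π / (h₂ x / 2), fun ε hε _ => ?_⟩
  · rw [← Real.closedBall_eq_Icc]
    exact inter_mem (mem_nhdsWithin_of_mem_nhds (Metric.closedBall_mem_nhds x hr))
      self_mem_nhdsWithin
  · rw [Icc_inter_Icc]
    refine lintegral_inv_sq_add_sq_le_of_le_deriv ?_ (hh.mono hsub)
      (fun y hy => hd y ?_) (hh₂.mono hsub) (by linarith) hε fun y hy => ?_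
    · exact (sup_le (by linarith) hx.1).trans (le_inf (by linarith) hx.2)
    · exact ⟨(le_max_right _ _).trans_lt hy.1, hy.2.trans_le (min_le_right _ _)⟩
    · rw [← Icc_inter_Icc] at hy
      exact le_of_lt (hball hy)

/-- If a `C¹` function and its derivative have no common zero, its sublevel sets near zero have
size of linear order. -/
lemma exists_lintegral_inv_sq_add_sq_le (hh : ContinuousOn h (Icc p q))
    (hd : ∀ x ∈ Ioo p q, HasDerivAt h (h₂ x) x) (hh₂ : ContinuousOn h₂ (Icc p q))
    (hne : ∀ x ∈ Icc p q, h x = 0 → h₂ x ≠ 0) :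
    ∃ C : ℝ, ∀ ε : ℝ, 0 < ε → ε ≤ 1 →
      ∫⁻ x in Icc p q, ENNReal.ofReal (1 / (h x ^ 2 + ε ^ 2)) ≤ ENNReal.ofReal (C / ε) := by
  refine isCompact_Icc.induction_on (p := fun t => ∃ C : ℝ, ∀ ε : ℝ, 0 < ε → ε ≤ 1 →
      ∫⁻ x in t, ENNReal.ofReal (1 / (h x ^ 2 + ε ^ 2)) ≤ ENNReal.ofReal (C / ε))
    ⟨0, by simp⟩ ?_ ?_ ?_
  · rintro s t hst ⟨C, hC⟩
    exact ⟨C, fun ε h0 h1 => (lintegral_mono_set hst).trans (hC ε h0 h1)⟩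
  · rintro s t ⟨C, hC⟩ ⟨D, hD⟩
    refine ⟨max C 0 + max D 0, fun ε h0 h1 => (lintegral_union_le _ s t).trans ?_⟩
    rw [add_div, ENNReal.ofReal_add (by positivity) (by positivity)]
    exact add_le_add ((hC ε h0 h1).trans (ENNReal.ofReal_le_ofReal (by gcongr; exact le_max_left _ _)))
      ((hD ε h0 h1).trans (ENNReal.ofReal_le_ofReal (by gcongr; exact le_max_left _ _)))
  · intro x hx
    -- Near a zero of `h` the derivative keeps its sign and the arctangent bound applies. Elsewhere
    -- the integrand is locally bounded, and `ε ≤ 1` turns a constant into a multiple of `1 / ε`.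
    by_cases h0 : h x = 0
    · rcases (hne x hx h0).lt_or_gt with hneg | hpos
      · have := lintegral_inv_sq_add_sq_le_of_deriv_pos (h := fun y => - h y)
          (h₂ := fun y => - h₂ y) hx hh.neg (fun y hy => (hd y hy).neg) hh₂.neg (by linarith)
        simpa using this
      · exact lintegral_inv_sq_add_sq_le_of_deriv_pos hx hh hd hh₂ hpos
    · have hsq : 0 < h x ^ 2 := by positivity
      have hev : ∀ᶠ y in 𝓝[Icc p q] x, h x ^ 2 / 2 < h y ^ 2 :=
        ((hh x hx).pow 2).eventually (lt_mem_nhds (by simp only [Pi.pow_apply]; linarith))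
      refine ⟨{y | h x ^ 2 / 2 < h y ^ 2} ∩ Icc p q,
        inter_mem hev self_mem_nhdsWithin, (2 / h x ^ 2) * max (q - p) 0, fun ε hε hε1 => ?_⟩
      have hbd : ∀ y ∈ {y | h x ^ 2 / 2 < h y ^ 2} ∩ Icc p q,
          ENNReal.ofReal (1 / (h y ^ 2 + ε ^ 2)) ≤ ENNReal.ofReal (2 / h x ^ 2) := by
        rintro y ⟨hy, -⟩
        refine ENNReal.ofReal_le_ofReal ?_
        rw [div_le_div_iff₀ (by positivity) hsq]
        have : h x ^ 2 / 2 < h y ^ 2 := hy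
        nlinarith [sq_nonneg ε]
      calc _ ≤ ∫⁻ y in {y | h x ^ 2 / 2 < h y ^ 2} ∩ Icc p q, ENNReal.ofReal (2 / h x ^ 2) :=
            setLIntegral_mono measurable_const hbd
        _ ≤ ENNReal.ofReal (2 / h x ^ 2) * ENNReal.ofReal (q - p) := by
            rw [setLIntegral_const, ← Real.volume_Icc]
            gcongr
            exact inter_subset_right
        _ ≤ _ := by
            rw [← ENNReal.ofReal_mul (by positivity)]
            refine ENNReal.ofReal_le_ofReal ?_
            rw [le_div_iff₀ hε]
            have h1 : 2 / h x ^ 2 * (q - p) * ε ≤ 2 / h x ^ 2 * max (q - p) 0 * ε := by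
              gcongr
              exact le_max_left _ _
            exact h1.trans (mul_le_of_le_one_right (by positivity) hε1)

/-- Integration by parts against the regularised multiplier `h / (h ^ 2 + ε ^ 2)`. -/
lemma norm_integral_cexp_le_of_inv_sq (hpq : p ≤ q) (hgc : ContinuousOn g (Icc p q))
    (hgd : ∀ x ∈ Ioo p q, HasDerivAt g (h x) x) (hh : ContinuousOn h (Icc p q))
    (hd : ∀ x ∈ Ioo p q, HasDerivAt h (h₂ x) x) (hh₂ : ContinuousOn h₂ (Icc p q))
    {K A ε u : ℝ} (hK : ∀ x ∈ Icc p q, |h₂ x| ≤ K) (hε : 0 < ε)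
    (hA : ∫ x in p..q, 1 / (h x ^ 2 + ε ^ 2) ≤ A) :
    |u| * ‖∫ x in p..q, Complex.exp (u * g x * Complex.I)‖ ≤ 1 / ε + (|u| * ε ^ 2 + K) * A := by
  have hK0 : 0 ≤ K := (abs_nonneg _).trans (hK p ⟨le_rfl, hpq⟩)
  have hpos : ∀ x, 0 < h x ^ 2 + ε ^ 2 := fun x => by positivity
  have hcI : ContinuousOn (fun x => 1 / (h x ^ 2 + ε ^ 2)) (Icc p q) :=
    continuousOn_const.div (by fun_prop) fun x _ => (hpos x).ne'
  -- Integrating by parts against `1 / h` would fail at zeros of `h`. Its regularisation `ψ`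
  -- satisfies `h * ψ + ρ = 1`, where the error `ρ` is concentrated near those zeros, and `|ψ| ≤ 1 /
  -- (2 * ε)`.
  set ψ : ℝ → ℝ := fun x => h x / (h x ^ 2 + ε ^ 2) with hψ
  set ψ' : ℝ → ℝ := fun x => h₂ x * (ε ^ 2 - h x ^ 2) / (h x ^ 2 + ε ^ 2) ^ 2 with hψ'
  set ρ : ℝ → ℝ := fun x => ε ^ 2 / (h x ^ 2 + ε ^ 2) with hρ
  have hψc : ContinuousOn ψ (Icc p q) := hh.div (by fun_prop) fun x _ => (hpos x).ne'
  have hψ'c : ContinuousOn ψ' (Icc p q) :=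
    ContinuousOn.div (by fun_prop) (by fun_prop) fun x _ => (pow_pos (hpos x) 2).ne'
  have hρc : ContinuousOn ρ (Icc p q) :=
    continuousOn_const.div (by fun_prop) fun x _ => (hpos x).ne'
  have hψd : ∀ x ∈ Ioo p q, HasDerivAt ψ (ψ' x) x := by
    intro x hx
    refine ((hd x hx).div (((hd x hx).pow 2).add_const (ε ^ 2)) (hpos x).ne').congr_deriv ?_
    simp only [hψ']
    congr 1
    simp
    ring
  have hψb : ∀ x, |ψ x| ≤ 1 / (2 * ε) := by
    intro x
    rw [hψ, abs_div, abs_of_pos (hpos x), div_le_div_iff₀ (hpos x) (by positivity)]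
    nlinarith [sq_nonneg (|h x| - ε), sq_abs (h x)]
  set E : ℝ → ℂ := fun x => Complex.exp (u * g x * Complex.I) with hE
  have hEc : ContinuousOn E (Icc p q) := by
    refine Complex.continuous_exp.comp_continuousOn ?_
    exact (continuousOn_const.mul (Complex.continuous_ofReal.comp_continuousOn hgc)).mul
      continuousOn_const
  have hEn : ∀ x, ‖E x‖ = 1 := fun x => by
    simp only [hE]
    rw [← Complex.ofReal_mul, Complex.norm_exp_ofReal_mul_I]
  have hEd : ∀ x ∈ Ioo p q, HasDerivAt E (E x * (u * h x * Complex.I)) x := by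
    intro x hx
    exact ((((hgd x hx).ofReal_comp).const_mul (u : ℂ)).mul_const Complex.I).cexp
  have oc : ∀ {k : ℝ → ℝ}, ContinuousOn k (Icc p q) →
      ContinuousOn (fun x => (k x : ℂ)) (Icc p q) :=
    fun hk => Complex.continuous_ofReal.comp_continuousOn hk
  have hψcc := oc hψc
  have hψ'cc := oc hψ'c
  have hρcc := oc hρc
  have hhcc := oc hh
  have hftc := intervalIntegral.integral_eq_sub_of_hasDerivAt_of_le hpq
      (f := fun x => E x * (ψ x : ℂ))
      (f' := fun x => E x * (u * h x * Complex.I) * ψ x + E x * (ψ' x : ℂ))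
      (by fun_prop) (fun x hx => (hEd x hx).mul (hψd x hx).ofReal_comp)
      (ContinuousOn.intervalIntegrable_of_Icc hpq (by fun_prop))
  set R : ℝ → ℂ := fun x => E x * (u * ρ x * Complex.I - ψ' x) with hR
  have hRc : ContinuousOn R (Icc p q) := by fun_prop
  have hsplit : (u * Complex.I) * ∫ x in p..q, E x =
      (E q * ψ q - E p * ψ p) + ∫ x in p..q, R x := by
    rw [← hftc, ← intervalIntegral.integral_const_mul, ← intervalIntegral.integral_add
      (ContinuousOn.intervalIntegrable_of_Icc hpq (by fun_prop))
      (hRc.intervalIntegrable_of_Icc hpq)]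
    refine intervalIntegral.integral_congr fun x _ => ?_
    have h1 : (h x * ψ x : ℝ) + ρ x = 1 := by
      simp only [hψ, hρ]
      have := (hpos x).ne'
      field_simp
    have h2 : (h x : ℂ) * ψ x + ρ x = 1 := by exact_mod_cast h1
    simp only [hR]
    linear_combination (-(u * Complex.I * E x)) * h2
  have hRb : ∀ x ∈ Icc p q, ‖R x‖ ≤ (|u| * ε ^ 2 + K) * (1 / (h x ^ 2 + ε ^ 2)) := by
    intro x hx
    simp only [hR]
    rw [norm_mul, hEn, one_mul]
    refine (norm_sub_le _ _).trans ?_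
    rw [norm_mul, norm_mul, Complex.norm_I, mul_one, Complex.norm_real, Complex.norm_real,
      Complex.norm_real, Real.norm_eq_abs, Real.norm_eq_abs, Real.norm_eq_abs, add_mul]
    refine add_le_add (le_of_eq ?_) ?_
    · rw [hρ, abs_of_pos (div_pos (by positivity) (hpos x))]
      ring
    · rw [hψ', abs_div, abs_of_pos (pow_pos (hpos x) 2), abs_mul, mul_one_div,
        div_le_div_iff₀ (pow_pos (hpos x) 2) (hpos x)]
      have h1 : |ε ^ 2 - h x ^ 2| ≤ h x ^ 2 + ε ^ 2 := by
        rw [abs_le]; constructor <;> nlinarith [sq_nonneg ε, sq_nonneg (h x)]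
      have h2 : |h₂ x| * |ε ^ 2 - h x ^ 2| ≤ K * (h x ^ 2 + ε ^ 2) :=
        mul_le_mul (hK x hx) h1 (abs_nonneg _) hK0
      nlinarith [hpos x]
  have hRint : ‖∫ x in p..q, R x‖ ≤ (|u| * ε ^ 2 + K) * A := by
    refine (intervalIntegral.norm_integral_le_integral_norm hpq).trans ?_
    refine (intervalIntegral.integral_mono_on hpq (hRc.norm.intervalIntegrable_of_Icc hpq)
      ((hcI.intervalIntegrable_of_Icc hpq).const_mul _) hRb).trans ?_
    rw [intervalIntegral.integral_const_mul]
    gcongr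
  have hn : |u| * ‖∫ x in p..q, E x‖ = ‖(u * Complex.I) * ∫ x in p..q, E x‖ := by
    rw [norm_mul, norm_mul, Complex.norm_I, mul_one, Complex.norm_real, Real.norm_eq_abs]
  rw [hn, hsplit]
  refine (norm_add_le _ _).trans (add_le_add ?_ hRint)
  refine (norm_sub_le _ _).trans ?_
  rw [norm_mul, norm_mul, hEn, hEn, one_mul, one_mul, Complex.norm_real, Complex.norm_real]
  have h1 := hψb q
  have h2 := hψb p
  have h3 : 1 / ε = 1 / (2 * ε) + 1 / (2 * ε) := by field_simp; norm_num
  rw [h3]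
  exact add_le_add h1 h2

/-- Van der Corput's estimate for a phase whose first two derivatives have no common zero. -/
theorem exists_norm_integral_cexp_le (hpq : p ≤ q) (hgc : ContinuousOn g (Icc p q))
    (hgd : ∀ x ∈ Ioo p q, HasDerivAt g (h x) x) (hh : ContinuousOn h (Icc p q))
    (hd : ∀ x ∈ Ioo p q, HasDerivAt h (h₂ x) x) (hh₂ : ContinuousOn h₂ (Icc p q))
    (hne : ∀ x ∈ Icc p q, h x = 0 → h₂ x ≠ 0) :
    ∃ C : ℝ, ∀ u : ℝ, ‖∫ x in p..q, Complex.exp (u * g x * Complex.I)‖ ≤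
      C * (1 + ‖u‖) ^ (-(1 / 2) : ℝ) := by
  obtain ⟨C₀, hC₀⟩ := exists_lintegral_inv_sq_add_sq_le hh hd hh₂ hne
  obtain ⟨K, hK⟩ := isCompact_Icc.exists_bound_of_continuousOn hh₂
  have hK0 : 0 ≤ K := (norm_nonneg _).trans (hK p ⟨le_rfl, hpq⟩)
  set C := max C₀ 0 with hC
  have hC0 : 0 ≤ C := le_max_right _ _
  set D := 1 + C + K * C with hD
  have hD0 : 0 ≤ D := by positivity
  have hconv : ∀ u : ℝ, (1 + ‖u‖) ^ (-(1 / 2) : ℝ) = 1 / √(1 + |u|) := fun u => by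
    rw [Real.rpow_neg (by positivity), Real.sqrt_eq_rpow, Real.norm_eq_abs, one_div (_ ^ _)]
  refine ⟨√2 * (D + (q - p)), fun u => ?_⟩
  rw [hconv, mul_one_div, le_div_iff₀ (by positivity)]
  have hqp : 0 ≤ q - p := by linarith
  rcases le_or_gt 1 |u| with hu | hu
  · have hu0 : 0 < |u| := by linarith
    -- This choice makes `|u| * ε ^ 2 = 1`, so that boundary terms and error are both of order
    -- `√|u|`.
    set ε := 1 / √|u| with hεdef
    have hs : 0 < √|u| := Real.sqrt_pos.2 hu0
    have hs1 : 1 ≤ √|u| := Real.one_le_sqrt.2 hu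
    have hss : √|u| * √|u| = |u| := Real.mul_self_sqrt hu0.le
    have hε : 0 < ε := by positivity
    have hε1 : ε ≤ 1 := by rw [hεdef, div_le_one hs]; exact hs1
    have hA : ∫ x in p..q, 1 / (h x ^ 2 + ε ^ 2) ≤ C / ε := by
      rw [intervalIntegral.integral_of_le hpq, ← integral_Icc_eq_integral_Ioc]
      have hcI : ContinuousOn (fun x => 1 / (h x ^ 2 + ε ^ 2)) (Icc p q) :=
        continuousOn_const.div (by fun_prop) fun x _ => by positivity
      have := hC₀ ε hε hε1
      rw [← ofReal_integral_eq_lintegral_ofReal (hcI.integrableOn_compact isCompact_Icc)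
        (Eventually.of_forall fun x => by positivity)] at this
      rw [← ENNReal.ofReal_le_ofReal_iff (by positivity)]
      exact this.trans (ENNReal.ofReal_le_ofReal (by gcongr; exact le_max_left _ _))
    have hmain := norm_integral_cexp_le_of_inv_sq hpq hgc hgd hh hd hh₂ (u := u)
      (fun x hx => hK x hx) hε hA
    have hrhs : 1 / ε + (|u| * ε ^ 2 + K) * (C / ε) = D * √|u| := by
      have h1 : |u| * ε ^ 2 = 1 := by
        rw [hεdef, div_pow, sq_sqrt hu0.le]; field_simp
      rw [h1, hεdef, hD]
      field_simp
      ring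
    have hI : √|u| * ‖∫ x in p..q, Complex.exp (u * g x * Complex.I)‖ ≤ D := by
      refine le_of_mul_le_mul_left ?_ hs
      rw [← mul_assoc, hss, mul_comm _ D]
      exact hmain.trans_eq hrhs
    have h2 : √(1 + |u|) ≤ √2 * √|u| := by
      rw [← Real.sqrt_mul (by norm_num)]
      exact Real.sqrt_le_sqrt (by linarith)
    calc _ ≤ ‖∫ x in p..q, Complex.exp (u * g x * Complex.I)‖ * (√2 * √|u|) := by gcongr
      _ = √2 * (√|u| * ‖∫ x in p..q, Complex.exp (u * g x * Complex.I)‖) := by ring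
      _ ≤ √2 * (D + (q - p)) := by gcongr; linarith
  · have h1 : ‖∫ x in p..q, Complex.exp (u * g x * Complex.I)‖ ≤ 1 * |q - p| := by
      refine intervalIntegral.norm_integral_le_of_norm_le_const fun x _ => ?_
      rw [← Complex.ofReal_mul, Complex.norm_exp_ofReal_mul_I]
    rw [abs_of_nonneg hqp, one_mul] at h1
    have h2 : √(1 + |u|) ≤ √2 := Real.sqrt_le_sqrt (by linarith)
    calc _ ≤ (q - p) * √2 := by gcongr
      _ ≤ √2 * (D + (q - p)) := by nlinarith [Real.sqrt_nonneg 2]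

end OscillatoryIntegral

/-! ### Poisson counts, Campbell's theorem and the multinomial computation. -/

section Poisson

open Filter Topology

lemma lintegral_natCast_poissonMeasure (r : ℝ≥0) : ∫⁻ n, (n : ℝ≥0∞) ∂(poissonMeasure r) = r := by
  rw [lintegral_countable', tsum_eq_zero_add' ENNReal.summable]
  have h : ∀ n : ℕ, ((n + 1 : ℕ) : ℝ≥0∞) * poissonMeasure r {n + 1} = r * poissonMeasure r {n} := by
    intro n
    rw [poissonMeasure_singleton, poissonMeasure_singleton, ← ENNReal.ofReal_natCast,
      ← ENNReal.ofReal_coe_nnreal, ← ENNReal.ofReal_mul (by positivity),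
      ← ENNReal.ofReal_mul (by positivity)]
    congr 1
    rw [Nat.factorial_succ]
    push_cast
    field_simp
    ring
  simp_rw [h]
  rw [ENNReal.tsum_mul_left]
  have := lintegral_countable' (μ := poissonMeasure r) (fun _ => 1)
  simp only [lintegral_one, one_mul, measure_univ] at this
  rw [← this]
  simp

/-- The multinomial theorem, in exponential form. -/
lemma sum_piAntidiag_prod_pow_div_factorial {κ : Type*} [Fintype κ] [DecidableEq κ] (x : κ → ℂ)
    (k : ℕ) :
    ∑ r ∈ Finset.univ.piAntidiag k, ∏ j, x j ^ r j / (r j).factorial =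
      (∑ j, x j) ^ k / k.factorial := by
  rw [Finset.sum_pow_eq_sum_piAntidiag, Finset.sum_div]
  refine Finset.sum_congr rfl fun r hr => ?_
  have hs : (∏ j, (r j).factorial) * Nat.multinomial Finset.univ r = k.factorial := by
    rw [Nat.multinomial_spec, (Finset.mem_piAntidiag.1 hr).1]
  rw [Finset.prod_div_distrib, ← hs]
  push_cast
  have h1 : (Nat.multinomial Finset.univ r : ℂ) ≠ 0 := by
    exact_mod_cast Nat.multinomial_pos _ _ |>.ne'
  have h2 : (∏ j, ((r j).factorial : ℂ)) ≠ 0 :=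
    Finset.prod_ne_zero_iff.2 fun j _ => by exact_mod_cast Nat.factorial_ne_zero _
  field_simp

/-- If the total is `k`, all counts are finite and exactly one composition `r` of `k` matches them.
The right side consists of products of functions of single counts, to which independence applies. -/
lemma ite_sum_eq_prod_pow_toNat {κ : Type*} [Fintype κ] [DecidableEq κ] (N : κ → ℕ∞) (w : κ → ℂ)
    (k : ℕ) :
    (if ∑ j, N j = (k : ℕ∞) then ∏ j, w j ^ (N j).toNat else 0) =
      ∑ r ∈ Finset.univ.piAntidiag k, ∏ j, if N j = (r j : ℕ∞) then w j ^ r j else 0 := by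
  split_ifs with h
  · have hfin : ∀ j, N j ≠ ⊤ := by
      intro j hj
      have : N j ≤ ∑ j, N j := Finset.single_le_sum (fun _ _ => zero_le) (Finset.mem_univ j)
      rw [h, hj] at this
      exact absurd this (by simp)
    have hN : ∀ j, N j = ((N j).toNat : ℕ∞) := fun j => (ENat.natCast_toNat (hfin j)).symm
    rw [Finset.sum_eq_single (fun j => (N j).toNat)]
    · refine Finset.prod_congr rfl fun j _ => ?_
      rw [if_pos (hN j)]
    · intro r _ hne
      obtain ⟨j, hj⟩ := Function.ne_iff.1 hne
      refine Finset.prod_eq_zero (Finset.mem_univ j) (if_neg fun h' => hj ?_)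
      rw [h', ENat.toNat_natCast]
    · intro hmem
      exfalso
      refine hmem (Finset.mem_piAntidiag.2 ⟨?_, by simp⟩)
      have : ((∑ j, (N j).toNat : ℕ) : ℕ∞) = k := by
        rw [← h, Nat.cast_sum]
        exact Finset.sum_congr rfl fun j _ => (hN j).symm
      exact_mod_cast this
  · refine (Finset.sum_eq_zero fun r hr => ?_).symm
    by_contra hne
    refine h ?_
    rw [← ne_eq, Finset.prod_ne_zero_iff] at hne
    have : ∀ j, N j = r j := fun j => by
      by_contra h'
      exact hne j (Finset.mem_univ j) (if_neg h')
    rw [← (Finset.mem_piAntidiag.1 hr).1]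
    push_cast
    exact Finset.sum_congr rfl fun j _ => this j

variable {ι Ω : Type*} {τ : ι → Ω → ℝ}

lemma count_eq_tsum (B : Set ℝ) (ω : Ω) :
    (count τ B ω : ℝ≥0∞) = ∑' i, B.indicator (fun _ => (1 : ℝ≥0∞)) (τ i ω) := by
  rw [count, ← ENNReal.tsum_set_one, tsum_subtype {i | τ i ω ∈ B} (fun _ => (1 : ℝ≥0∞))]
  rfl

lemma hasSum_indicator_count {B : Set ℝ} {ω : Ω} (h : count τ B ω ≠ ⊤) (c : ℝ) :
    HasSum (fun i => B.indicator (fun _ => c) (τ i ω)) (c * (count τ B ω).toNat) := by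
  have hf : {i | τ i ω ∈ B}.Finite := Set.encard_ne_top_iff.1 h
  have h1 := hasSum_sum_of_ne_finset_zero (L := .unconditional ι) (f := fun i => B.indicator (fun _ => c) (τ i ω))
    (s := hf.toFinset) (fun i hi => by
      rw [Set.indicator_of_notMem]
      simpa using hi)
  convert h1 using 1
  rw [Finset.sum_congr rfl (g := fun _ => c) (fun i hi => Set.indicator_of_mem (by simpa using hi) _),
    Finset.sum_const, nsmul_eq_mul, mul_comm, count, hf.encard_eq_coe_toFinset_card,
    ENat.toNat_natCast]

lemma count_iUnion {κ : Type*} [Fintype κ] {B : κ → Set ℝ}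
    (hB : Pairwise (fun j k => Disjoint (B j) (B k))) (ω : Ω) :
    count τ (⋃ j, B j) ω = ∑ j, count τ (B j) ω := by
  have h : {i | τ i ω ∈ ⋃ j, B j} = ⋃ j, {i | τ i ω ∈ B j} := by ext; simp
  rw [count, h, Set.encard_iUnion_of_finite, finsum_eq_sum_of_fintype]
  · rfl
  · intro j k hjk
    exact Set.disjoint_left.2 fun i hi hi' => Set.disjoint_left.1 (hB hjk) hi hi'

variable [MeasurableSpace Ω] {ν : Measure ℝ} {P : Measure Ω}

namespace IsPoissonPointProcess

lemma measurable_count [Countable ι] (hτ : IsPoissonPointProcess τ ν P) {B : Set ℝ}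
    (hB : MeasurableSet B) : Measurable (count τ B) := by
  refine measurable_encard.comp (measurable_set_iff.2 fun i => ?_)
  exact (measurable_mem.2 hB).comp (hτ.measurable i)

lemma measurable_tsum_comp [Countable ι] (hτ : IsPoissonPointProcess τ ν P) {f : ℝ → ℝ}
    (hf : Measurable f) : Measurable fun ω => ∑' i, f (τ i ω) :=
  Measurable.tsum fun i => hf.comp (hτ.measurable i)

lemma ae_count_ne_top (hτ : IsPoissonPointProcess τ ν P) {B : Set ℝ} (hB : MeasurableSet B)
    (hν : ν B ≠ ∞) : ∀ᵐ ω ∂P, count τ B ω ≠ ⊤ := by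
  have h := hτ.count_law B hB hν
  have h2 : ∀ᵐ x ∂((poissonMeasure (ν B).toNNReal).map (fun k : ℕ => (k : ℕ∞))), x ≠ ⊤ := by
    rw [ae_map_iff (by fun_prop) (by measurability)]
    simp
  rw [← h.map_eq] at h2
  exact ae_of_ae_map h.aemeasurable h2

lemma lintegral_count [Countable ι] [IsProbabilityMeasure P] (hτ : IsPoissonPointProcess τ ν P)
    {B : Set ℝ} (hB : MeasurableSet B) : ∫⁻ ω, (count τ B ω : ℝ≥0∞) ∂P = ν B := by
  by_cases hν : ν B = ∞
  · rw [lintegral_congr_ae (g := fun _ => ∞)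
      ((hτ.count_top B hB hν).mono fun ω h => by simp [h]), hν]
    simp
  · rw [(hτ.count_law B hB hν).lintegral_comp (f := fun x : ℕ∞ => (x : ℝ≥0∞))
      (Measurable.of_discrete).aemeasurable, lintegral_map Measurable.of_discrete (by fun_prop)]
    simp only [ENat.toENNReal_coe]
    rw [lintegral_natCast_poissonMeasure, ENNReal.coe_toNNReal hν]

/-- The intensity measure of the points is `ν`. -/
lemma sum_map_eq [Countable ι] [IsProbabilityMeasure P] (hτ : IsPoissonPointProcess τ ν P) :
    Measure.sum (fun i => P.map (τ i)) = ν := by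
  ext B hB
  rw [← hτ.lintegral_count hB, Measure.sum_apply _ hB]
  simp_rw [count_eq_tsum]
  have hm : ∀ i, Measurable fun ω => B.indicator (fun _ => (1 : ℝ≥0∞)) (τ i ω) := fun i =>
    (measurable_const.indicator hB).comp (hτ.measurable i)
  rw [lintegral_tsum fun i => (hm i).aemeasurable]
  refine tsum_congr fun i => ?_
  rw [← lintegral_map (μ := P) (measurable_const.indicator hB) (hτ.measurable i),
    lintegral_indicator_const hB, one_mul]

/-- Campbell's theorem. -/
lemma lintegral_tsum_comp [Countable ι] [IsProbabilityMeasure P]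
    (hτ : IsPoissonPointProcess τ ν P) {f : ℝ → ℝ≥0∞} (hf : Measurable f) :
    ∫⁻ ω, ∑' i, f (τ i ω) ∂P = ∫⁻ x, f x ∂ν := by
  have hm : ∀ i, Measurable fun ω => f (τ i ω) := fun i => hf.comp (hτ.measurable i)
  rw [lintegral_tsum fun i => (hm i).aemeasurable, ← hτ.sum_map_eq,
    lintegral_sum_measure]
  exact tsum_congr fun i => (lintegral_map hf (hτ.measurable i)).symm

lemma ae_summable [Countable ι] [IsProbabilityMeasure P] (hτ : IsPoissonPointProcess τ ν P)
    {f : ℝ → ℝ} (hf : Measurable f) (hi : Integrable f ν) :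
    ∀ᵐ ω ∂P, Summable (fun i => f (τ i ω)) := by
  have h := hτ.lintegral_tsum_comp (f := fun x => ‖f x‖ₑ) hf.enorm
  have h2 : ∀ᵐ ω ∂P, ∑' i, ‖f (τ i ω)‖ₑ < ∞ := by
    refine ae_lt_top' (AEMeasurable.tsum fun i =>
      (hf.enorm.comp (hτ.measurable i)).aemeasurable) ?_
    rw [h]
    exact hi.2.ne
  filter_upwards [h2] with ω hω
  refine Summable.of_enorm ?_
  exact hω.ne

lemma iIndepFun_count (hτ : IsPoissonPointProcess τ ν P) {κ : Type*} [Fintype κ]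
    {B : κ → Set ℝ} (hBm : ∀ j, MeasurableSet (B j))
    (hB : Pairwise (fun j k => Disjoint (B j) (B k))) : iIndepFun (fun j => count τ (B j)) P := by
  have e := Fintype.equivFin κ
  have h := hτ.indep _ (fun j => B (e.symm j)) (fun j => hBm _)
    (fun j k hjk => hB (e.symm.injective.ne hjk))
  simpa using h.precomp e.injective

lemma norm_integral_pow_count_le_one [IsProbabilityMeasure P] {B : Set ℝ} {w : ℂ}
    (hw : ‖w‖ ≤ 1) : ‖∫ ω, w ^ (count τ B ω).toNat ∂P‖ ≤ 1 := by
  refine (norm_integral_le_of_norm_le_const (C := 1) (Eventually.of_forall fun ω => ?_)).trans ?_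
  · rw [norm_pow]
    exact pow_le_one₀ (norm_nonneg _) hw
  · simp

lemma integral_ite_count (hτ : IsPoissonPointProcess τ ν P) {B : Set ℝ}
    (hB : MeasurableSet B) (hν : ν B ≠ ∞) (z : ℂ) (n : ℕ) :
    ∫ ω, (if count τ B ω = (n : ℕ∞) then z else 0) ∂P =
      (Real.exp (-ν.real B) : ℂ) * ((ν.real B : ℂ) ^ n / n.factorial * z) := by
  have h := (hτ.count_law B hB hν).integral_comp
    (f := fun x : ℕ∞ => if x = (n : ℕ∞) then z else 0)
    (Measurable.of_discrete).aestronglyMeasurable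
  simp only [Function.comp_def] at h
  rw [h, integral_map (Measurable.of_discrete).aemeasurable
    (Measurable.of_discrete).aestronglyMeasurable, integral_poissonMeasure,
    tsum_eq_single n (fun m hm => by simp [hm])]
  simp only [if_true, Complex.real_smul]
  push_cast
  rw [measureReal_def]
  ring

/-- Discrete form of the conditioning argument: the `inl` pieces make up the window, the `inr`
pieces lie outside it. Independence factors each composition of `k`, the Poisson weights recombine
by the multinomial theorem, and the outer factor `c` has modulus at most 1. -/
theorem norm_integral_prod_pow_count_le [Countable ι] [IsProbabilityMeasure P]
    (hτ : IsPoissonPointProcess τ ν P)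
    {κ₁ κ₂ : Type*} [Fintype κ₁] [Fintype κ₂] {B : κ₁ ⊕ κ₂ → Set ℝ}
    (hBm : ∀ j, MeasurableSet (B j)) (hB : Pairwise (fun j k => Disjoint (B j) (B k)))
    (hν : ∀ j, ν (B j) ≠ ∞) {w : κ₁ ⊕ κ₂ → ℂ} (hw : ∀ j, ‖w j‖ ≤ 1) (k : ℕ) :
    ‖∫ ω in {ω | ∑ j, count τ (B (Sum.inl j)) ω = (k : ℕ∞)},
        ∏ j, w j ^ (count τ (B j) ω).toNat ∂P‖ ≤
      Real.exp (-∑ j, ν.real (B (Sum.inl j))) *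
        (‖∑ j, (ν.real (B (Sum.inl j)) : ℂ) * w (Sum.inl j)‖ ^ k / k.factorial) := by
  classical
  have hcm : ∀ j, Measurable (count τ (B j)) := fun j => hτ.measurable_count (hBm j)
  have hms : MeasurableSet {ω | ∑ j, count τ (B (Sum.inl j)) ω = (k : ℕ∞)} := by
    have : Measurable fun ω => ∑ j, count τ (B (Sum.inl j)) ω := by fun_prop
    exact this (measurableSet_singleton _)
  set F : (κ₁ → ℕ) → κ₁ ⊕ κ₂ → ℕ∞ → ℂ := fun r j x =>
    Sum.elim (fun j₁ => if x = (r j₁ : ℕ∞) then w (Sum.inl j₁) ^ r j₁ else 0)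
      (fun j₂ => w (Sum.inr j₂) ^ x.toNat) j with hF
  set c : ℂ := ∏ j, ∫ ω, w (Sum.inr j) ^ (count τ (B (Sum.inr j)) ω).toNat ∂P with hc
  have hc1 : ‖c‖ ≤ 1 := by
    rw [hc, norm_prod]
    exact Finset.prod_le_one (fun _ _ => norm_nonneg _)
      fun j _ => norm_integral_pow_count_le_one (hw _)
  have hpt : ∀ ω, {ω | ∑ j, count τ (B (Sum.inl j)) ω = (k : ℕ∞)}.indicator
      (fun ω => ∏ j, w j ^ (count τ (B j) ω).toNat) ω =
      ∑ r ∈ Finset.univ.piAntidiag k, ∏ j, F r j (count τ (B j) ω) := by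
    intro ω
    simp only [Set.indicator_apply, Set.mem_ofPred_eq, Fintype.prod_sum_type, hF, Sum.elim_inl,
      Sum.elim_inr]
    rw [← Finset.sum_mul, ← ite_sum_eq_prod_pow_toNat, ite_mul, zero_mul]
  have hFb : ∀ r j x, ‖F r j x‖ ≤ 1 := by
    intro r j x
    rcases j with j | j
    · simp only [hF, Sum.elim_inl]
      split_ifs
      · rw [norm_pow]; exact pow_le_one₀ (norm_nonneg _) (hw _)
      · simp
    · simp only [hF, Sum.elim_inr, norm_pow]
      exact pow_le_one₀ (norm_nonneg _) (hw _)
  have hint : ∀ r, Integrable (fun ω => ∏ j, F r j (count τ (B j) ω)) P := by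
    intro r
    refine Integrable.of_bound (C := 1) (Measurable.aestronglyMeasurable ?_)
      (Eventually.of_forall fun ω => ?_)
    · exact Finset.measurable_prod _ fun j _ => (Measurable.of_discrete (f := F r j)).comp (hcm j)
    · rw [norm_prod]
      exact Finset.prod_le_one (fun _ _ => norm_nonneg _) fun j _ => hFb _ _ _
  have heq : ∫ ω in {ω | ∑ j, count τ (B (Sum.inl j)) ω = (k : ℕ∞)},
        ∏ j, w j ^ (count τ (B j) ω).toNat ∂P =
      (Real.exp (-∑ j, ν.real (B (Sum.inl j))) : ℂ) *
        ((∑ j, (ν.real (B (Sum.inl j)) : ℂ) * w (Sum.inl j)) ^ k / k.factorial) * c := by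
    rw [← integral_indicator hms, integral_congr_ae (Eventually.of_forall hpt),
      integral_finsetSum _ fun r _ => hint r, ← sum_piAntidiag_prod_pow_div_factorial,
      Finset.mul_sum, Finset.sum_mul]
    refine Finset.sum_congr rfl fun r _ => ?_
    rw [(hτ.iIndepFun_count hBm hB).integral_fun_prod_comp (fun j => (hcm j).aemeasurable)
      (fun j => (Measurable.of_discrete).aestronglyMeasurable), Fintype.prod_sum_type]
    simp only [hF, Sum.elim_inl, Sum.elim_inr]
    rw [← hc]
    congr 1
    rw [← Finset.sum_neg_distrib, Real.exp_sum, Complex.ofReal_prod, ← Finset.prod_mul_distrib]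
    refine Finset.prod_congr rfl fun j _ => ?_
    rw [hτ.integral_ite_count (hBm _) (hν _), mul_pow]
    ring
  rw [heq, norm_mul, norm_mul, norm_div, norm_pow, Complex.norm_real, Real.norm_eq_abs,
    abs_of_pos (Real.exp_pos _), Complex.norm_natCast]
  exact mul_le_of_le_one_right (by positivity) hc1

end IsPoissonPointProcess

end Poisson

/-! ### Bounding the characteristic function by powers of the oscillatory integral. -/

section CharFunBound

open Filter Topology

variable {ι Ω : Type*} {τ : ι → Ω → ℝ} [Countable ι] [MeasurableSpace Ω] {ν : Measure ℝ}
  {P : Measure Ω} [IsProbabilityMeasure P]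

lemma norm_cexp_mul_mul_I (u x : ℝ) : ‖Complex.exp (u * x * Complex.I)‖ = 1 := by
  rw [← Complex.ofReal_mul, Complex.norm_exp_ofReal_mul_I]

/-- Pieces on which a simple function is constant, inside and outside a set `W`; the piece
outside `W` where the function vanishes is omitted. -/
def simplePiece (F : SimpleFunc ℝ ℝ) (W : Set ℝ) : F.range ⊕ F.range.erase 0 → Set ℝ :=
  Sum.elim (fun c => F ⁻¹' {c.1} ∩ W) (fun c => F ⁻¹' {c.1} ∩ Wᶜ)

/-- The value of the simple function on a piece. -/
def simpleValue (F : SimpleFunc ℝ ℝ) : F.range ⊕ F.range.erase 0 → ℝ :=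
  Sum.elim (fun c => c.1) (fun c => c.1)

lemma measurableSet_simplePiece (F : SimpleFunc ℝ ℝ) {W : Set ℝ} (hW : MeasurableSet W)
    (j : F.range ⊕ F.range.erase 0) : MeasurableSet (simplePiece F W j) := by
  rcases j with j | j
  · exact (F.measurableSet_preimage _).inter hW
  · exact (F.measurableSet_preimage _).inter hW.compl

lemma pairwise_disjoint_simplePiece (F : SimpleFunc ℝ ℝ) (W : Set ℝ) :
    Pairwise (fun j k => Disjoint (simplePiece F W j) (simplePiece F W k)) := by
  intro j k hjk
  rw [Set.disjoint_left]
  rintro x hx hx'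
  rcases j with j | j <;> rcases k with k | k <;>
    simp only [simplePiece, Sum.elim_inl, Sum.elim_inr, mem_inter_iff, mem_preimage,
      mem_singleton_iff, mem_compl_iff] at hx hx'
  · exact hjk (congrArg _ (Subtype.ext (hx.1.symm.trans hx'.1)))
  · exact hx'.2 hx.2
  · exact hx.2 hx'.2
  · exact hjk (congrArg _ (Subtype.ext (hx.1.symm.trans hx'.1)))

/-- Outside `W` only nonzero values are kept, and integrability makes their level sets finite in
measure. The zero level set may have infinite measure but contributes nothing to the sum. -/
lemma measure_simplePiece_ne_top (F : SimpleFunc ℝ ℝ) (hF : Integrable F ν) {W : Set ℝ}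
    (hν : ν W ≠ ∞) (j : F.range ⊕ F.range.erase 0) : ν (simplePiece F W j) ≠ ∞ := by
  rcases j with j | j
  · exact measure_ne_top_of_subset inter_subset_right hν
  · exact measure_ne_top_of_subset inter_subset_left
      (F.measure_preimage_lt_top_of_integrable hF (Finset.ne_of_mem_erase j.2)).ne

lemma iUnion_simplePiece_inl (F : SimpleFunc ℝ ℝ) (W : Set ℝ) :
    ⋃ j, simplePiece F W (Sum.inl j) = W := by
  ext x
  simp [simplePiece]

lemma simpleFunc_eq_sum_indicator (F : SimpleFunc ℝ ℝ) (W : Set ℝ) (x : ℝ) :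
    F x = ∑ j, (simplePiece F W j).indicator (fun _ => simpleValue F j) x := by
  classical
  by_cases hx : x ∈ W
  · rw [Finset.sum_eq_single (Sum.inl ⟨F x, F.mem_range_self x⟩)]
    · simp [simplePiece, simpleValue, hx]
    · rintro j - hj
      refine Set.indicator_of_notMem (fun hmem => hj ?_) _
      rcases j with j | j
      · exact congrArg _ (Subtype.ext hmem.1.symm)
      · exact absurd hx hmem.2
    · simp
  · by_cases h0 : F x = 0
    · rw [h0]
      refine (Finset.sum_eq_zero fun j _ => Set.indicator_of_notMem (fun hmem => ?_) _).symm
      rcases j with j | j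
      · exact hx hmem.2
      · exact Finset.ne_of_mem_erase j.2 (hmem.1.symm.trans h0)
    · rw [Finset.sum_eq_single (Sum.inr ⟨F x, Finset.mem_erase.2 ⟨h0, F.mem_range_self x⟩⟩)]
      · simp [simplePiece, simpleValue, hx]
      · rintro j - hj
        refine Set.indicator_of_notMem (fun hmem => hj ?_) _
        rcases j with j | j
        · exact absurd hmem.2 hx
        · exact congrArg _ (Subtype.ext hmem.1.symm)
      · simp

lemma setIntegral_comp_simpleFunc (F : SimpleFunc ℝ ℝ) {W : Set ℝ}
    (hν : ν W ≠ ∞) (φ : ℝ → ℂ) :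
    ∫ x in W, φ (F x) ∂ν = ∑ j, (ν.real (simplePiece F W (Sum.inl j)) : ℂ) * φ j.1 := by
  have hpt : ∀ x, φ (F x) = ∑ j : F.range, (F ⁻¹' {j.1}).indicator (fun _ => φ j.1) x := by
    classical
    intro x
    rw [Finset.sum_eq_single ⟨F x, F.mem_range_self x⟩]
    · simp
    · rintro j - hj
      exact Set.indicator_of_notMem (fun hmem => hj (Subtype.ext hmem.symm)) _
    · simp
  have : IsFiniteMeasure (ν.restrict W) := ⟨by simpa using hν.lt_top⟩
  rw [integral_congr_ae (Eventually.of_forall hpt), integral_finsetSum]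
  · refine Finset.sum_congr rfl fun j _ => ?_
    rw [integral_indicator_const _ (F.measurableSet_preimage _),
      measureReal_restrict_apply (F.measurableSet_preimage _), Complex.real_smul]
    rfl
  · intro j _
    exact (integrable_const _).indicator (F.measurableSet_preimage _)

namespace IsPoissonPointProcess

lemma norm_setIntegral_cexp_simpleFunc_le (hτ : IsPoissonPointProcess τ ν P)
    (F : SimpleFunc ℝ ℝ) (hF : Integrable F ν) {W : Set ℝ} (hW : MeasurableSet W)
    (hν : ν W ≠ ∞) (u : ℝ) (k : ℕ) :
    ‖∫ ω in {ω | count τ W ω = (k : ℕ∞)},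
        Complex.exp (u * (∑' i, F (τ i ω) : ℝ) * Complex.I) ∂P‖ ≤
      Real.exp (-ν.real W) *
        (‖∫ x in W, Complex.exp (u * F x * Complex.I) ∂ν‖ ^ k / k.factorial) := by
  have hBm := measurableSet_simplePiece F hW
  have hB := pairwise_disjoint_simplePiece F W
  have hBν := measure_simplePiece_ne_top F hF hν
  have hB1 : Pairwise (fun j k => Disjoint (simplePiece F W (Sum.inl j))
      (simplePiece F W (Sum.inl k))) := fun j k hjk => hB (Sum.inl_injective.ne hjk)
  have h := hτ.norm_integral_prod_pow_count_le hBm hB hBν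
    (w := fun j => Complex.exp (u * simpleValue F j * Complex.I))
    (fun j => (norm_cexp_mul_mul_I _ _).le) k
  have hset : {ω | ∑ j, count τ (simplePiece F W (Sum.inl j)) ω = (k : ℕ∞)} =
      {ω | count τ W ω = (k : ℕ∞)} := by
    ext ω
    simp only [mem_ofPred_eq]
    rw [← count_iUnion hB1, iUnion_simplePiece_inl]
  have hmass : ∑ j, ν.real (simplePiece F W (Sum.inl j)) = ν.real W := by
    rw [← iUnion_simplePiece_inl F W, measureReal_iUnion_fintype hB1 (fun j => hBm _)
      (fun j => hBν _)]
    simp_rw [iUnion_simplePiece_inl]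
  have hI : ∑ j, (ν.real (simplePiece F W (Sum.inl j)) : ℂ) *
      Complex.exp (u * simpleValue F (Sum.inl j) * Complex.I) =
      ∫ x in W, Complex.exp (u * F x * Complex.I) ∂ν :=
    (setIntegral_comp_simpleFunc F hν fun c => Complex.exp (u * c * Complex.I)).symm
  rw [hset, hmass, hI] at h
  refine le_of_eq_of_le (congrArg _ (integral_congr_ae (ae_restrict_of_ae ?_))) h
  -- Finiteness is needed because `toNat` sends `⊤` to 0.
  have hfin : ∀ᵐ ω ∂P, ∀ j, count τ (simplePiece F W j) ω ≠ ⊤ :=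
    ae_all_iff.2 fun j => hτ.ae_count_ne_top (hBm j) (hBν j)
  filter_upwards [hfin] with ω hω
  have hs : HasSum (fun i => F (τ i ω))
      (∑ j, simpleValue F j * (count τ (simplePiece F W j) ω).toNat) := by
    simp_rw [simpleFunc_eq_sum_indicator F W]
    exact hasSum_sum fun j _ => hasSum_indicator_count (hω j) _
  rw [hs.tsum_eq]
  simp_rw [← Complex.exp_nat_mul]
  rw [← Complex.exp_sum]
  congr 1
  push_cast
  rw [Finset.mul_sum, Finset.sum_mul]
  exact Finset.sum_congr rfl fun j _ => by ring

/-- Passage to the limit from simple functions `F n` with `|F n| ≤ 2 * |f|`; Campbell's theorem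
makes this bound almost surely summable over the points. -/
lemma norm_setIntegral_cexp_count_eq_le (hτ : IsPoissonPointProcess τ ν P)
    {f : ℝ → ℝ} (hf : Measurable f) (hfi : Integrable f ν) {W : Set ℝ} (hW : MeasurableSet W)
    (hν : ν W ≠ ∞) (u : ℝ) (k : ℕ) :
    ‖∫ ω in {ω | count τ W ω = (k : ℕ∞)},
        Complex.exp (u * (∑' i, f (τ i ω) : ℝ) * Complex.I) ∂P‖ ≤
      Real.exp (-ν.real W) *
        (‖∫ x in W, Complex.exp (u * f x * Complex.I) ∂ν‖ ^ k / k.factorial) := by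
  have : IsFiniteMeasure (ν.restrict W) := ⟨by simpa using hν.lt_top⟩
  set F : ℕ → SimpleFunc ℝ ℝ := fun n => SimpleFunc.approxOn f hf univ 0 (mem_univ _) n with hF
  have hFi : ∀ n, Integrable (F n) ν := fun n =>
    SimpleFunc.integrable_approxOn hf hfi _ (integrable_zero _ _ _) n
  have hFlim : ∀ x, Tendsto (fun n => F n x) atTop (𝓝 (f x)) := fun x =>
    SimpleFunc.tendsto_approxOn hf _ (by simp)
  have hFb : ∀ n x, ‖F n x‖ ≤ ‖f x‖ + ‖f x‖ := fun n x =>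
    SimpleFunc.norm_approxOn_zero_le hf _ x n
  have hcexp : Continuous fun y : ℝ => Complex.exp (u * y * Complex.I) := by fun_prop
  refine le_of_tendsto_of_tendsto' (b := atTop) ?_ ?_
    (fun n => hτ.norm_setIntegral_cexp_simpleFunc_le (F n) (hFi n) hW hν u k)
  · refine Tendsto.norm (tendsto_integral_of_dominated_convergence (fun _ => (1 : ℝ)) ?_
      (integrable_const _) ?_ ?_)
    · intro n
      exact (hcexp.measurable.comp
        (hτ.measurable_tsum_comp (F n).measurable)).aestronglyMeasurable
    · intro n
      exact Eventually.of_forall fun ω => (norm_cexp_mul_mul_I _ _).le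
    · refine ae_restrict_of_ae ?_
      filter_upwards [hτ.ae_summable hf.norm hfi.norm] with ω hω
      refine (hcexp.tendsto _).comp ?_
      exact tendsto_tsum_of_dominated_convergence (hω.add hω) (fun i => hFlim _)
        (Eventually.of_forall fun n i => hFb n _)
  · refine Tendsto.const_mul _ (Tendsto.div_const (Tendsto.pow (Tendsto.norm ?_) k) _)
    refine tendsto_integral_of_dominated_convergence (fun _ => (1 : ℝ)) ?_
      (integrable_const _) ?_ ?_
    · intro n
      exact (hcexp.measurable.comp (F n).measurable).aestronglyMeasurable
    · intro n
      exact Eventually.of_forall fun x => (norm_cexp_mul_mul_I _ _).le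
    · exact Eventually.of_forall fun x => (hcexp.tendsto _).comp (hFlim x)

/-- On the event that `W` contains at least `k₀ ≥ 3` points, the characteristic function of a shot
noise sum is bounded by the cube of the oscillatory integral over `W`. -/
theorem norm_setIntegral_cexp_le_count_le (hτ : IsPoissonPointProcess τ ν P)
    {f : ℝ → ℝ} (hf : Measurable f) (hfi : Integrable f ν) {W : Set ℝ} (hW : MeasurableSet W)
    (hν : ν W ≠ ∞) (u : ℝ) {k₀ : ℕ} (hk₀ : 3 ≤ k₀) :
    ‖∫ ω in {ω | (k₀ : ℕ∞) ≤ count τ W ω},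
        Complex.exp (u * (∑' i, f (τ i ω) : ℝ) * Complex.I) ∂P‖ ≤
      ‖∫ x in W, Complex.exp (u * f x * Complex.I) ∂ν‖ ^ 3 := by
  set J := ‖∫ x in W, Complex.exp (u * f x * Complex.I) ∂ν‖ with hJ
  have hJν : J ≤ ν.real W := by
    refine (norm_setIntegral_le_of_norm_le_const hν.lt_top
      (C := 1) fun x _ => (norm_cexp_mul_mul_I _ _).le).trans ?_
    rw [one_mul]
  have hcm := hτ.measurable_count hW
  -- Indexing by `k + 3` lets `J ^ 3` be factored out; since `(k + 3)! ≥ k!`, the remaining series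
  -- is dominated by that of `exp J`.
  set s : ℕ → Set Ω := fun k => {ω | count τ W ω = ((k + 3 : ℕ) : ℕ∞) ∧ k₀ ≤ k + 3} with hs
  have hsm : ∀ k, MeasurableSet (s k) := fun k =>
    (hcm (measurableSet_singleton _)).inter (MeasurableSet.const _)
  have hsd : Pairwise (Function.onFun Disjoint s) := by
    intro j k hjk
    refine Set.disjoint_left.2 fun ω hj hk => hjk ?_
    have := hj.1.symm.trans hk.1
    have : j + 3 = k + 3 := by exact_mod_cast this
    omega
  have hset : ({ω | (k₀ : ℕ∞) ≤ count τ W ω} : Set Ω) =ᵐ[P] ⋃ k, s k := by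
    filter_upwards [hτ.ae_count_ne_top hW hν] with ω hω
    refine propext ?_
    change (k₀ : ℕ∞) ≤ count τ W ω ↔ ω ∈ ⋃ k, s k
    obtain ⟨n, hn⟩ := ENat.ne_top_iff_exists.1 hω
    simp only [hs, mem_iUnion, mem_ofPred_eq, ← hn, Nat.cast_le, Nat.cast_inj]
    constructor
    · intro h
      exact ⟨n - 3, by omega, by omega⟩
    · rintro ⟨k, h1, h2⟩
      omega
  set e : Ω → ℂ := fun ω => Complex.exp (u * (∑' i, f (τ i ω) : ℝ) * Complex.I) with he
  have hem : Measurable e := by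
    have hcexp : Continuous fun y : ℝ => Complex.exp (u * y * Complex.I) := by fun_prop
    exact hcexp.measurable.comp (hτ.measurable_tsum_comp hf)
  have hei : Integrable e P :=
    Integrable.of_bound hem.aestronglyMeasurable 1
      (Eventually.of_forall fun ω => (norm_cexp_mul_mul_I _ _).le)
  rw [setIntegral_congr_set hset, ← (hasSum_integral_iUnion hsm hsd hei.integrableOn).tsum_eq]
  have hterm : ∀ k, ‖∫ ω in s k, e ω ∂P‖ ≤ Real.exp (-ν.real W) * J ^ 3 * (J ^ k / k.factorial) := by
    intro k
    by_cases hk : k₀ ≤ k + 3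
    · have : s k = {ω | count τ W ω = ((k + 3 : ℕ) : ℕ∞)} := by
        ext ω; simp only [hs, mem_ofPred_eq, hk, and_true]
      rw [this]
      refine (hτ.norm_setIntegral_cexp_count_eq_le hf hfi hW hν u (k + 3)).trans ?_
      rw [← hJ, mul_assoc, ← mul_div_assoc (J ^ 3), ← pow_add, add_comm 3 k]
      gcongr
      omega
    · have : s k = ∅ := by
        ext ω; simp only [hs, mem_ofPred_eq, hk, and_false, mem_empty_iff_false]
      rw [this]
      simp only [Measure.restrict_empty, integral_zero_measure, norm_zero]
      positivity
  refine (tsum_of_norm_bounded ((NormedSpace.expSeries_div_hasSum_exp J).mul_left _) hterm).trans ?_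
  rw [← Real.exp_eq_exp_ℝ, mul_right_comm, ← Real.exp_add]
  -- The factor `exp (J - ν W)` is at most 1 because `J ≤ ν W`.
  refine mul_le_of_le_one_left (by positivity) (Real.exp_le_one_iff.2 (by linarith))

end IsPoissonPointProcess

end CharFunBound

/-! ### From the decay estimate to the conditional density. -/

section Density

open Filter Topology

variable {ι Ω : Type*} {τ : ι → Ω → ℝ} [Countable ι] [MeasurableSpace Ω]
  {P : Measure Ω} [IsProbabilityMeasure P]

/-- Conditioning only multiplies the characteristic function on the event by `(P S)⁻¹`; the cube of
the decay `-1/2` is then integrable. The kernel `f` is kept general so that truncated sums are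
covered as well. -/
lemma IsPoissonPointProcess.hasContinuousBoundedDensity_cond {lam : ℝ} (hlam : 0 < lam)
    (hτ : IsPoissonPointProcess τ (ENNReal.ofReal lam • volume) P) {f : ℝ → ℝ}
    (hf : Measurable f) (hfi : Integrable f) {p q C : ℝ}
    (hC : ∀ u : ℝ, ‖∫ x in Icc p q, Complex.exp (u * f x * Complex.I)‖ ≤
      C * (1 + ‖u‖) ^ (-(1 / 2) : ℝ))
    {k₀ : ℕ} (hk₀ : 3 ≤ k₀) {Y : Ω → ℝ} (hY : ∀ᵐ ω ∂P, Y ω = ∑' i, f (τ i ω)) :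
    HasContinuousBoundedDensity Y P[|{ω | (k₀ : ℕ∞) ≤ count τ (Icc p q) ω}] := by
  set S : Set Ω := {ω | (k₀ : ℕ∞) ≤ count τ (Icc p q) ω} with hS
  set Z : Ω → ℝ := fun ω => ∑' i, f (τ i ω) with hZ
  have hZm : Measurable Z := hτ.measurable_tsum_comp hf
  have hYZ : Y =ᵐ[P[|S]] Z := cond_absolutelyContinuous.ae_le hY
  have hYm : AEMeasurable Y P[|S] := hZm.aemeasurable.congr hYZ.symm
  have hmap : (P[|S]).map Y = (P[|S]).map Z := Measure.map_congr hYZ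
  have hνfin : (ENNReal.ofReal lam • volume : Measure ℝ) (Icc p q) ≠ ∞ := by
    rw [Measure.smul_apply, Real.volume_Icc, smul_eq_mul]
    exact ENNReal.mul_ne_top ENNReal.ofReal_ne_top ENNReal.ofReal_ne_top
  have hcexp : ∀ u : ℝ, Continuous fun y : ℝ => Complex.exp (u * y * Complex.I) := fun u => by
    fun_prop
  have hbound : ∀ u : ℝ, ‖charFun ((P[|S]).map Y) u‖ ≤
      ((P S)⁻¹.toReal * (lam * C) ^ 3) * (1 + ‖u‖) ^ (-(3 / 2) : ℝ) := by
    intro u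
    rw [hmap, charFun_apply_real, integral_map hZm.aemeasurable
      (hcexp u).measurable.aestronglyMeasurable, ProbabilityTheory.cond, integral_smul_measure,
      norm_smul, Real.norm_of_nonneg ENNReal.toReal_nonneg, mul_assoc]
    refine mul_le_mul_of_nonneg_left ?_ ENNReal.toReal_nonneg
    refine (hτ.norm_setIntegral_cexp_le_count_le hf (hfi.smul_measure ENNReal.ofReal_ne_top)
      measurableSet_Icc hνfin u hk₀).trans ?_
    have hpow : (1 + ‖u‖) ^ (-(3 / 2) : ℝ) = ((1 + ‖u‖) ^ (-(1 / 2) : ℝ)) ^ 3 := by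
      rw [← Real.rpow_natCast, ← Real.rpow_mul (by positivity)]
      norm_num
    rw [hpow, ← mul_pow]
    refine pow_le_pow_left₀ (norm_nonneg _) ?_ 3
    rw [Measure.restrict_smul, integral_smul_measure, norm_smul,
      Real.norm_of_nonneg ENNReal.toReal_nonneg, ENNReal.toReal_ofReal hlam.le, mul_assoc]
    exact mul_le_mul_of_nonneg_left (hC u) hlam.le
  have hint : Integrable (charFun ((P[|S]).map Y)) :=
    ((integrable_one_add_norm (r := 3 / 2) (by norm_num)).const_mul _).mono'
      continuous_charFun.aestronglyMeasurable (Eventually.of_forall hbound)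
  obtain ⟨d, hdc, hd0, hdb, hd⟩ := exists_continuous_density_of_integrable_charFun _ hint
  exact ⟨d, hdc, hd0, hdb, ⟨hYm, hd⟩⟩

/-- The oscillatory integral of `x ↦ g (t - x)` over a window of radius `T` centred at `t - s`. -/
lemma exists_norm_setIntegral_cexp_comp_sub_le {T a b : ℝ} (hT : 0 < T) {g : ℝ → ℝ}
    (hg : ContDiffOn ℝ 2 g (Icc (-T + a) (T + b)))
    (hne : ∀ x ∈ Icc (-T + a) (T + b), iteratedDerivWithin 1 g (Icc (-T + a) (T + b)) x = 0 →
      iteratedDerivWithin 2 g (Icc (-T + a) (T + b)) x ≠ 0) (t : ℝ) {s : ℝ} (hs : s ∈ Icc a b) :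
    ∃ C : ℝ, ∀ u : ℝ, ‖∫ x in Icc (t - s - T) (t - s + T),
      Complex.exp (u * g (t - x) * Complex.I)‖ ≤ C * (1 + ‖u‖) ^ (-(1 / 2) : ℝ) := by
  set J := Icc (-T + a) (T + b) with hJ
  have hU : UniqueDiffOn ℝ J := uniqueDiffOn_Icc (by linarith [hs.1, hs.2])
  have hsub : Icc (s - T) (s + T) ⊆ J :=
    Icc_subset_Icc (by linarith [hs.1]) (by linarith [hs.2])
  -- At interior points of `J` the derivatives within `J` are genuine two-sided derivatives.
  have hnhds : ∀ x ∈ Ioo (s - T) (s + T), J ∈ 𝓝 x := fun x hx =>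
    mem_of_superset (Icc_mem_nhds hx.1 hx.2) hsub
  have hmem : ∀ x ∈ Ioo (s - T) (s + T), x ∈ J := fun x hx => hsub (Ioo_subset_Icc_self hx)
  obtain ⟨C, hC⟩ := exists_norm_integral_cexp_le (p := s - T) (q := s + T) (g := g)
    (h := iteratedDerivWithin 1 g J) (h₂ := iteratedDerivWithin 2 g J) (by linarith)
    (hg.continuousOn.mono hsub)
    (fun x hx => by
      have := ((hg.differentiableOn (by norm_num)) x (hmem x hx)).hasDerivWithinAt.hasDerivAt
        (hnhds x hx)
      rwa [iteratedDerivWithin_one])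
    ((hg.continuousOn_iteratedDerivWithin (by norm_num) hU).mono hsub)
    (fun x hx => by
      have := ((hg.differentiableOn_iteratedDerivWithin (m := 1) (by norm_num) hU) x
        (hmem x hx)).hasDerivWithinAt.hasDerivAt (hnhds x hx)
      rwa [← iteratedDerivWithin_succ] at this)
    ((hg.continuousOn_iteratedDerivWithin le_rfl hU).mono hsub)
    (fun x hx => hne x (hsub hx))
  refine ⟨C, fun u => ?_⟩
  have hcv : ∫ x in Icc (t - s - T) (t - s + T), Complex.exp (u * g (t - x) * Complex.I) =
      ∫ x in (s - T)..(s + T), Complex.exp (u * g x * Complex.I) := by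
    rw [integral_Icc_eq_integral_Ioc, ← intervalIntegral.integral_of_le (by linarith),
      intervalIntegral.integral_comp_sub_left (fun x => Complex.exp (u * g x * Complex.I)) t]
    congr 1 <;> ring
  rw [hcv]
  exact hC u

end Density

end ShotNoise

open ShotNoise in
theorem proposition6 {Ω ι : Type*} [MeasurableSpace Ω] [Countable ι]
    (P : Measure Ω) [IsProbabilityMeasure P]
    (lam : ℝ) (hlam : 0 < lam)
    (τ : ι → Ω → ℝ) (hτ : IsPoissonPointProcess τ (ENNReal.ofReal lam • volume) P)
    (β : ι → Ω → ℝ) (hβ : ∀ i, ∀ᵐ ω ∂P, β i ω = 1)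
    (T a b : ℝ) (hT : 0 < T) (hab : a < b)
    (g : ℝ → ℝ) (hg_meas : Measurable g) (hg_int : Integrable g volume)
    (hg : ContDiffOn ℝ 2 g (Icc (-T + a) (T + b)))
    (m : ℝ)
    (hm : IsLeast ((fun s => √(iteratedDerivWithin 1 g (Icc (-T + a) (T + b)) s ^ 2 +
      iteratedDerivWithin 2 g (Icc (-T + a) (T + b)) s ^ 2)) '' Icc (-T + a) (T + b)) m)
    (hm_pos : 0 < m)
    (hn₀ : {s ∈ Icc (-T + a) (T + b) |
      iteratedDerivWithin 2 g (Icc (-T + a) (T + b)) s = 0}.Finite)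
    (k₀ : ℕ) (hk₀ : 3 ≤ k₀) :
    -- the series defining the process converges absolutely a.s.
    (∀ t : ℝ, ∀ᵐ ω ∂P, Summable (fun i => β i ω * g (t - τ i ω))) ∧
    -- the truncated processes, given at least `k₀` points in `[-T, T]`
    (∀ t ∈ Icc a b, ∀ M, T ≤ M →
      HasContinuousBoundedDensity (truncShotNoise β g τ M t)
        P[|{ω | (k₀ : ℕ∞) ≤ count τ (Icc (-T) T) ω}]) ∧
    -- the full process, given at least `k₀` points in `[-T, T]`
    (∀ t ∈ Icc a b,
      HasContinuousBoundedDensity (shotNoise β g τ t)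
        P[|{ω | (k₀ : ℕ∞) ≤ count τ (Icc (-T) T) ω}]) ∧
    -- the full process at any time, given at least `k₀` points in the translated window
    (∀ t : ℝ, ∀ s ∈ Icc a b,
      HasContinuousBoundedDensity (shotNoise β g τ t)
        P[|{ω | (k₀ : ℕ∞) ≤ count τ (Icc (t - s - T) (t - s + T)) ω}]) := by
  have hβ' : ∀ᵐ ω ∂P, ∀ i, β i ω = 1 := ae_all_iff.2 hβ
  have hgm : ∀ t : ℝ, Measurable fun x => g (t - x) := fun t => by fun_prop
  have hgi : ∀ t : ℝ, Integrable fun x => g (t - x) := fun t => hg_int.comp_sub_left t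
  have hne : ∀ x ∈ Icc (-T + a) (T + b), iteratedDerivWithin 1 g (Icc (-T + a) (T + b)) x = 0 →
      iteratedDerivWithin 2 g (Icc (-T + a) (T + b)) x ≠ 0 := by
    intro x hx h1 h2
    have := hm.2 (mem_image_of_mem _ hx)
    simp only [h1, h2] at this
    norm_num at this
    linarith
  have hfull : ∀ t : ℝ, ∀ s ∈ Icc a b, HasContinuousBoundedDensity (shotNoise β g τ t)
      P[|{ω | (k₀ : ℕ∞) ≤ count τ (Icc (t - s - T) (t - s + T)) ω}] := by
    intro t s hs
    obtain ⟨C, hC⟩ := exists_norm_setIntegral_cexp_comp_sub_le hT hg hne t hs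
    refine hτ.hasContinuousBoundedDensity_cond hlam (hgm t) (hgi t) hC hk₀ ?_
    filter_upwards [hβ'] with ω hω
    simp only [shotNoise, hω, one_mul]
  refine ⟨fun t => ?_, fun t ht M hM => ?_, fun t ht => ?_, hfull⟩
  · filter_upwards [hβ', hτ.ae_summable (hgm t) ((hgi t).smul_measure ENNReal.ofReal_ne_top)]
      with ω hω hsum
    simpa only [hω, one_mul] using hsum
  · obtain ⟨C, hC⟩ := exists_norm_setIntegral_cexp_comp_sub_le hT hg hne t ht
    simp only [sub_self, zero_sub, zero_add] at hC
    -- Truncation amounts to cutting the kernel off outside `[-M, M]`. As `T ≤ M`, the cut-off is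
    -- invisible on `[-T, T]`, so the same oscillatory bound serves.
    refine hτ.hasContinuousBoundedDensity_cond hlam
      (f := (Icc (-M) M).indicator fun x => g (t - x))
      ((hgm t).indicator measurableSet_Icc) ((hgi t).indicator measurableSet_Icc) (C := C) ?_ hk₀ ?_
    · intro u
      refine le_of_eq_of_le (congrArg _ (setIntegral_congr_fun measurableSet_Icc fun x hx => ?_))
        (hC u)
      rw [indicator_of_mem (Icc_subset_Icc (neg_le_neg hM) hM hx)]
    · filter_upwards [hβ'] with ω hω
      simp only [truncShotNoise, hω, one_mul]
      refine (tsum_subtype {i | |τ i ω| ≤ M} (fun i => g (t - τ i ω))).trans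
        (tsum_congr fun i => ?_)
      simp only [indicator_apply, mem_ofPred_eq, mem_Icc, abs_le]
  -- With `s = t` the translated window is `[-T, T]`.
  · simpa using hfull t t ht
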